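/- Let $q$ be an odd prime power and let $\mathbf{F}_q$ be the field with $q$ elements. Let $\mathrm{sym}(n)$ be the number of invertible symmetric $n\times n$ matrices over $\mathbf{F}_q$. For $0\le k\le n$, let $\mathrm{sym}_0(n,k)$ be the number of invertible symmetric $n\times n$ matrices over $\mathbf{F}_q$ whose first $k$ diagonal entries are $0$, and let $\mathrm{sym}_0^+(n,k)$ be the number of those whose determinant is a square in $\mathbf{F}_q$. Write $[n]_q=\frac{q^n-1}{q-1}$ and $[n]_q!!=[n]_q[n-2]_q[n-4]_q\cdots$ (the last factor being $[1]_q$ or $[2]_q$), with $[0]_q!!=[-1]_q!!=1$, and $\binom{a}{-1}=0$. Let $m,k\ge 0$ be integers. (1) If $k+1\le 2m$, then $$\mathrm{sym}_0(2m,k+1)=\frac{1}{q^{k+1}}\,\mathrm{sym}(2m).$$ (2) If $k+1\le 2m+1$, then $$\mathrm{sym}_0(2m+1,k+1)=\frac{q^{m^2+m}}{q^{k+1}}\sum_{j=0}^{\lfloor k/2\rfloor+1}(-1)^j(q-1)^{m+j}\,[2m-2j+1]_q!!\left(\binom{k+1}{2j-1}+(q-1)\binom{k+1}{2j}\right).$$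 (3) If $k+1\le 2m$, then $$\mathrm{sym}_0^+(2m,k+1)=\frac{\mathrm{sym}(2m)}{2q^{k+1}}+\frac{(-1)^t q^{m^2}}{2q^{k+1}}\sum_{j=0}^{\lceil k/2\rceil}(-1)^j(q-1)^{m+j}\,[2m-2j-1]_q!!\left(\binom{k+1}{2j}+(q-1)\binom{k+1}{2j+1}\right),$$ where $t=0$ if $(-1)^m$ is a square in $\mathbf{F}_q$ and $t=1$ otherwise. (4) If $k+1\le 2m+1$, then $$\mathrm{sym}_0^+(2m+1,k+1)=\tfrac12\,\mathrm{sym}_0(2m+1,k+1).$$ -/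

import Mathlib

/-- Invertible symmetric `n × n` matrices over `F`. -/
def SymInv (F : Type*) [Field F] (n : ℕ) : Set (Matrix (Fin n) (Fin n) F) :=
  {A | A.IsSymm ∧ IsUnit A}

/-- Invertible symmetric `n × n` matrices over `F` whose first `k` diagonal entries are zero. -/
def Symz (F : Type*) [Field F] (n k : ℕ) : Set (Matrix (Fin n) (Fin n) F) :=
  {A | A.IsSymm ∧ IsUnit A ∧ ∀ i : Fin n, (i : ℕ) < k → A i i = 0}

/-- Invertible symmetric `n × n` matrices over `F` whose first `k` diagonal entries are zero and
whose determinant is a (nonzero) square in `F`, that is, whose quadratic character is `+`. -/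
def SymzPlus (F : Type*) [Field F] [Fintype F] [DecidableEq F] (n k : ℕ) :
    Set (Matrix (Fin n) (Fin n) F) :=
  {A | A ∈ Symz F n k ∧ quadraticChar F A.det = 1}

/-- The number of invertible symmetric `n × n` matrices. -/
noncomputable def sym (F : Type*) [Field F] (n : ℕ) : ℕ := (SymInv F n).ncard

/-- The number of invertible symmetric `n × n` matrices with first `k` diagonal entries zero. -/
noncomputable def symz (F : Type*) [Field F] (n k : ℕ) : ℕ := (Symz F n k).ncard

/-- The number of invertible symmetric `n × n` matrices with first `k` diagonal entries zero and
square determinant. -/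
noncomputable def symzPlus (F : Type*) [Field F] [Fintype F] [DecidableEq F] (n k : ℕ) : ℕ :=
  (SymzPlus F n k).ncard

/-- The `q`-number `[n]_q = (q ^ n - 1) / (q - 1)`. -/
def qNumber (q : ℚ) (n : ℤ) : ℚ := (q ^ n - 1) / (q - 1)

/-- The `q`-double factorial `[n]_q!! = [n]_q [n-2]_q [n-4]_q ⋯` for `n ≥ -1`, the last factor being
`[1]_q` or `[2]_q`; the product is empty for `n = 0` and `n = -1`, so `[0]_q!! = [-1]_q!! = 1`. -/
def qDoubleFactorial (q : ℚ) (n : ℤ) : ℚ :=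
  ∏ i ∈ Finset.range ((n + 1) / 2).toNat, qNumber q (n - 2 * (i : ℤ))

/-- The binomial coefficient `n` over `r` with an integer lower index; it is `0` when `r < 0`. -/
def binom (n : ℕ) (r : ℤ) : ℚ := if 0 ≤ r then (n.choose r.toNat : ℚ) else 0

open Classical in
/-- The exponent `t`: `0` if `(-1) ^ m` is a square in `F`, and `1` otherwise. -/
noncomputable def signExp (F : Type*) [Field F] (m : ℕ) : ℕ :=
  if IsSquare ((-1 : F) ^ m) then 0 else 1

/-!
For a multiplicative character `η`, let `S η n k` be the sum of `η (det A)` over the symmetric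
`n × n` matrices `A` whose first `k` diagonal entries vanish. With `1` the trivial and `χ` the
quadratic character, `S 1 n k` counts all invertible such `A`, and `(S 1 n k + S χ n k) / 2` counts
those whose determinant is a square.

Detect the vanishing of one more diagonal entry by Fourier inversion over `F`. By the Schur
complement of the block that remains after deleting the row and column of that entry, each
nontrivial frequency `d` contributes a Gauss sum of `η` times the exponential sum of a quadratic
form in `n` variables, which is a power of the quadratic Gauss sum times `χ` of a determinant. Hence
`q * S η (n + 1) (k + 1) - S η (n + 1) k` is a multiple of `S (η * χ) n k`, with a factor
`∑ d, (η * χ ^ n)⁻¹ d` that vanishes unless `η = χ ^ n`. If it vanishes, each prescribed zero just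
divides the sum by `q`. Otherwise the sums `S 1 (2 * m + 1)` and `S χ (2 * m)` are linked. The case
`k = 0` follows by comparing this with the Schur complement of a nonzero corner entry.

Removing the powers of `q` and the sign `χ (-1) ^ m`, the linked sums become sequences `u m k` and
`v m k` with `u m (k + 1) - u m k = -(q - 1) * v m k` and
`v (m + 1) (k + 1) - v (m + 1) k = (q - 1) * u m k`. The binomial coefficients in the closed forms
are those of the Newton expansion in `k` of the solution.
-/

open Finset Matrix

theorem addChar_map_sum {ι A M : Type*} [AddCommMonoid A] [CommMonoid M] (ψ : AddChar A M)
    (s : Finset ι) (f : ι → A) : ψ (∑ i ∈ s, f i) = ∏ i ∈ s, ψ (f i) :=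
  map_prod ψ.toMonoidHom (fun i => Multiplicative.ofAdd (f i)) s

section QuadraticGaussSums

variable {F R : Type*} [Field F] [Fintype F] [DecidableEq F] [CommRing R]

/-- The quadratic character of a finite field with values in a commutative ring `R`, so that it can
be paired with additive characters with values in `R`. -/
def quadraticMulChar (F R : Type*) [Field F] [Fintype F] [DecidableEq F] [CommRing R] :
    MulChar F R :=
  (quadraticChar F).ringHomComp (Int.castRingHom R)

theorem quadraticMulChar_apply (a : F) : quadraticMulChar F R a = (quadraticChar F a : R) := rfl

theorem isQuadratic_quadraticMulChar : (quadraticMulChar F R).IsQuadratic :=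
  (quadraticChar_isQuadratic F).comp _

theorem quadraticMulChar_ne_one [CharZero R] (hF : ringChar F ≠ 2) : quadraticMulChar F R ≠ 1 :=
  (MulChar.ringHomComp_ne_one_iff Int.cast_injective).2 (quadraticChar_ne_one hF)

theorem quadraticMulChar_sq {a : F} (ha : a ≠ 0) : quadraticMulChar F R a ^ 2 = 1 := by
  rw [quadraticMulChar_apply]
  exact_mod_cast congrArg (Int.cast : ℤ → R) (quadraticChar_sq_one ha)

theorem quadraticMulChar_inv (a : F) : quadraticMulChar F R a⁻¹ = quadraticMulChar F R a := by
  rw [← MulChar.inv_apply', isQuadratic_quadraticMulChar.inv]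

theorem quadraticMulChar_ringHomComp {R' : Type*} [CommRing R'] (f : R →+* R') :
    (quadraticMulChar F R).ringHomComp f = quadraticMulChar F R' := by
  ext a
  simp [quadraticMulChar_apply]

theorem gaussSum_quadraticMulChar_pow_two_mul [IsDomain R] [CharZero R] (hF : ringChar F ≠ 2)
    {ψ : AddChar F R} (hψ : ψ.IsPrimitive) (m : ℕ) :
    gaussSum (quadraticMulChar F R) ψ ^ (2 * m) =
      (quadraticMulChar F R (-1) * Fintype.card F) ^ m := by
  rw [pow_mul, gaussSum_sq (quadraticMulChar_ne_one hF) isQuadratic_quadraticMulChar hψ]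

theorem sum_addChar_sq [IsDomain R] (hF : ringChar F ≠ 2) {ψ : AddChar F R} (hψ : ψ ≠ 1) :
    ∑ x : F, ψ (x ^ 2) = gaussSum (quadraticMulChar F R) ψ := by
  have hfiber (a : F) : ∑ x : F with x ^ 2 = a, ψ (x ^ 2) =
      quadraticMulChar F R a * ψ a + ψ a := by
    have hcard : (#{x : F | x ^ 2 = a} : R) = quadraticMulChar F R a + 1 := by
      have h := quadraticChar_card_sqrts hF a
      rw [Set.toFinset_ofPred] at h
      rw [quadraticMulChar_apply]
      exact_mod_cast congrArg (Int.cast : ℤ → R) h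
    rw [sum_congr rfl (g := fun _ => ψ a) fun x hx => by rw [(mem_filter.1 hx).2], sum_const,
      nsmul_eq_mul, hcard, add_one_mul]
  rw [← sum_fiberwise univ (fun x : F => x ^ 2), sum_congr rfl fun a _ => hfiber a,
    sum_add_distrib, AddChar.sum_eq_zero_of_ne_one hψ, add_zero, gaussSum]

theorem sum_addChar_mul_sq [IsDomain R] (hF : ringChar F ≠ 2) {ψ : AddChar F R}
    (hψ : ψ.IsPrimitive) {d : F} (hd : d ≠ 0) :
    ∑ x : F, ψ (d * x ^ 2) = quadraticMulChar F R d * gaussSum (quadraticMulChar F R) ψ := by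
  have h := gaussSum_mulShift_eq (quadraticMulChar F R) ψ (Units.mk0 d hd)
  rw [isQuadratic_quadraticMulChar.inv, Units.val_mk0, ← sum_addChar_sq hF (hψ hd)] at h
  exact h

theorem sum_addChar_diagonal [IsDomain R] {ι : Type*} [Fintype ι] [DecidableEq ι]
    (hF : ringChar F ≠ 2) {ψ : AddChar F R} (hψ : ψ.IsPrimitive) {d : ι → F} (hd : ∀ i, d i ≠ 0) :
    ∑ v : ι → F, ψ (∑ i, d i * v i ^ 2) =
      quadraticMulChar F R (∏ i, d i) *
        gaussSum (quadraticMulChar F R) ψ ^ Fintype.card ι := by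
  have hsplit (v : ι → F) : ψ (∑ i, d i * v i ^ 2) = ∏ i, ψ (d i * v i ^ 2) :=
    addChar_map_sum ψ univ fun i => d i * v i ^ 2
  rw [sum_congr rfl fun v _ => hsplit v, ← Fintype.piFinset_univ,
    ← prod_univ_sum (fun _ : ι => (univ : Finset F)) (fun i x => ψ (d i * x ^ 2)),
    prod_congr rfl fun i _ => sum_addChar_mul_sq hF hψ (hd i), prod_mul_distrib, map_prod,
    prod_const, card_univ]

end QuadraticGaussSums

section QuadraticForms

variable {F : Type*} [Field F] {ι : Type*} [Fintype ι] [DecidableEq ι]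

theorem exists_congruent_diagonal (h2 : (2 : F) ≠ 0) {C : Matrix ι ι F} (hC : C.IsSymm) :
    ∃ (P : Matrix ι ι F) (d : ι → F), IsUnit P ∧ Pᵀ * C * P = diagonal d := by
  have : Invertible (2 : F) := invertibleOfNonzero h2
  have hsymm : LinearMap.IsSymm (toBilin' C) :=
    LinearMap.BilinForm.isSymm_iff.1 (isSymm_toBilin'_iff_isSymm.2 hC)
  obtain ⟨b, hb⟩ := LinearMap.BilinForm.exists_orthogonal_basis hsymm
  let e : Fin (Module.finrank F (ι → F)) ≃ ι :=
    (finCongr (Module.finrank_fintype_fun_eq_card F)).trans (Fintype.equivFin ι).symm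
  let c := b.reindex e
  have hc (i j : ι) (hij : i ≠ j) : toBilin' C (c i) (c j) = 0 := by
    simpa only [c, Module.Basis.reindex_apply] using hb (e.symm.injective.ne hij)
  have : Invertible ((Pi.basisFun F ι).toMatrix c) := (Pi.basisFun F ι).invertibleToMatrix c
  refine ⟨(Pi.basisFun F ι).toMatrix c, fun i => toBilin' C (c i) (c i),
    isUnit_of_invertible _, ?_⟩
  have hgram := LinearMap.BilinForm.toMatrix_mul_basis_toMatrix (Pi.basisFun F ι) c (toBilin' C)
  rw [LinearMap.BilinForm.toMatrix_basisFun, LinearMap.BilinForm.toMatrix'_toBilin'] at hgram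
  rw [hgram]
  ext i j
  rw [LinearMap.BilinForm.toMatrix_apply, diagonal_apply]
  split_ifs with hij
  · rw [hij]
  · exact hc i j hij

theorem sum_addChar_dotProduct_mulVec [Fintype F] [DecidableEq F] {R : Type*} [CommRing R]
    [IsDomain R] (hF : ringChar F ≠ 2) {ψ : AddChar F R} (hψ : ψ.IsPrimitive) {C : Matrix ι ι F}
    (hC : C.IsSymm) (hdet : C.det ≠ 0) :
    ∑ v : ι → F, ψ (v ⬝ᵥ C *ᵥ v) =
      quadraticMulChar F R C.det * gaussSum (quadraticMulChar F R) ψ ^ Fintype.card ι := by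
  obtain ⟨P, d, hP, hd⟩ := exists_congruent_diagonal (Ring.two_ne_zero hF) hC
  have hPdet : P.det ≠ 0 := ((isUnit_iff_isUnit_det P).1 hP).ne_zero
  have hprod : ∏ i, d i = P.det ^ 2 * C.det := by
    rw [← det_diagonal, ← hd, det_mul, det_mul, det_transpose]
    ring
  have hd0 (i : ι) : d i ≠ 0 :=
    prod_ne_zero_iff.1 (hprod ▸ mul_ne_zero (pow_ne_zero _ hPdet) hdet) i (mem_univ i)
  have hform (w : ι → F) : (P *ᵥ w) ⬝ᵥ C *ᵥ (P *ᵥ w) = ∑ i, d i * w i ^ 2 := calc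
    (P *ᵥ w) ⬝ᵥ C *ᵥ (P *ᵥ w) = w ⬝ᵥ (Pᵀ * C * P) *ᵥ w := by
      rw [← mulVec_mulVec, ← mulVec_mulVec, dotProduct_mulVec w, vecMul_transpose]
    _ = ∑ i, d i * w i ^ 2 := by
      rw [hd, dotProduct]
      exact sum_congr rfl fun i _ => by rw [mulVec_diagonal]; ring
  have hbij : Function.Bijective P.mulVec :=
    Finite.injective_iff_bijective.1 (mulVec_injective_of_isUnit hP)
  rw [← hbij.sum_comp, sum_congr rfl fun w _ => congrArg ψ (hform w),
    sum_addChar_diagonal hF hψ hd0, hprod, map_mul, map_pow, quadraticMulChar_sq hPdet, one_mul]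

end QuadraticForms

section Bordered

variable {F : Type*} {ι : Type*}

/-- The matrix with corner entry `a`, complementary block `B`, and the same vector `v` completing
both the first row and the first column. The corner is indexed by `Unit`. -/
def bordered (a : F) (v : ι → F) (B : Matrix ι ι F) : Matrix (Unit ⊕ ι) (Unit ⊕ ι) F :=
  fromBlocks (of fun _ _ => a) (replicateRow Unit v) (replicateCol Unit v) B

theorem isSymm_bordered_iff {a : F} {v : ι → F} {B : Matrix ι ι F} :
    (bordered a v B).IsSymm ↔ B.IsSymm := by
  rw [bordered, isSymm_fromBlocks_iff]
  exact ⟨fun h => h.2.2.2, fun h => ⟨rfl, rfl, rfl, h⟩⟩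

theorem bordered_toBlocks {A : Matrix (Unit ⊕ ι) (Unit ⊕ ι) F} (hA : A.IsSymm) :
    bordered (A (.inl ()) (.inl ())) (fun i => A (.inl ()) (.inr i)) A.toBlocks₂₂ = A := by
  ext (i | i) (j | j)
  · rfl
  · rfl
  · exact hA.apply _ _
  · rfl

variable [Field F] [Fintype ι] [DecidableEq ι]

theorem det_bordered_eq_add (a : F) (v : ι → F) (B : Matrix ι ι F) :
    (bordered a v B).det = a * B.det + (bordered 0 v B).det := by
  have hsplit : bordered a v B = (bordered 0 v B).updateRow (.inl ())
      (Sum.elim (fun _ => a) (0 : ι → F) + Sum.elim (0 : Unit → F) v) := by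
    ext (i | i) (j | j) <;> simp [bordered, updateRow_apply]
  have hcorner : (bordered 0 v B).updateRow (.inl ()) (Sum.elim (fun _ => a) (0 : ι → F)) =
      fromBlocks (of fun _ _ => a) 0 (replicateCol Unit v) B := by
    ext (i | i) (j | j) <;> simp [bordered, updateRow_apply]
  have hborder : (bordered 0 v B).updateRow (.inl ()) (Sum.elim (0 : Unit → F) v) =
      bordered 0 v B := by
    ext (i | i) (j | j) <;> simp [bordered, updateRow_apply]
  rw [hsplit, det_updateRow_add, hcorner, hborder, det_fromBlocks_zero₁₂, det_unique, of_apply]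

theorem det_bordered_of_det_ne_zero (a : F) (v : ι → F) {B : Matrix ι ι F} (hB : B.det ≠ 0) :
    (bordered a v B).det = (a - v ⬝ᵥ B⁻¹ *ᵥ v) * B.det := by
  let _ := B.invertibleOfIsUnitDet hB.isUnit
  rw [bordered, det_fromBlocks₂₂, invOf_eq_nonsing_inv, mul_comm, det_unique, Matrix.mul_assoc]
  rfl

theorem det_bordered_of_corner_ne_zero {a : F} (ha : a ≠ 0) (v : ι → F) (B : Matrix ι ι F) :
    (bordered a v B).det = a * (B - a⁻¹ • vecMulVec v v).det := by
  have hinv : (of fun _ _ : Unit => a) * (of fun _ _ : Unit => a⁻¹) = 1 := by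
    ext
    simp [mul_apply, ha]
  let _ := invertibleOfRightInverse _ _ hinv
  have hschur : replicateCol Unit v * (of fun _ _ : Unit => a⁻¹) * replicateRow Unit v =
      a⁻¹ • vecMulVec v v := by
    ext
    simp only [mul_apply, univ_unique, replicateCol_apply, of_apply, sum_const, card_singleton,
      one_smul, replicateRow_apply, Matrix.smul_apply, vecMulVec_apply, smul_eq_mul]
    ring
  rw [bordered, det_fromBlocks₁₁, det_unique, of_apply, invOf_eq_right_inv hinv, hschur]

end Bordered

section SymmetricMatrices

variable {F : Type*} [Field F] [Fintype F] {ι : Type*} [Fintype ι] [DecidableEq ι]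

open Classical in
/-- The finite set of symmetric matrices whose diagonal entries at the positions in `S` vanish.
The index type is arbitrary, so that deleting a row and the corresponding column needs no
renumbering. -/
noncomputable def symmZeroDiag (F : Type*) [Field F] [Fintype F] {ι : Type*} [Fintype ι]
    [DecidableEq ι] (S : Finset ι) : Finset (Matrix ι ι F) :=
  {A | A.IsSymm ∧ ∀ i ∈ S, A i i = 0}

theorem mem_symmZeroDiag {S : Finset ι} {A : Matrix ι ι F} :
    A ∈ symmZeroDiag F S ↔ A.IsSymm ∧ ∀ i ∈ S, A i i = 0 := by
  simp [symmZeroDiag]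

theorem bordered_mem_symmZeroDiag_disjSum {T : Finset Unit} {S : Finset ι} {a : F} {v : ι → F}
    {B : Matrix ι ι F} :
    bordered a v B ∈ symmZeroDiag F (T.disjSum S) ↔ B ∈ symmZeroDiag F S ∧ (() ∈ T → a = 0) := by
  rw [mem_symmZeroDiag, mem_symmZeroDiag, isSymm_bordered_iff, and_assoc]
  refine and_congr_right fun _ => ⟨fun h => ⟨fun i hi => h _ (inr_mem_disjSum.2 hi),
    fun hT => h _ (inl_mem_disjSum.2 hT)⟩, ?_⟩
  rintro ⟨hS, hT⟩ (i | i) hi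
  · exact hT (inl_mem_disjSum.1 hi)
  · exact hS i (inr_mem_disjSum.1 hi)

theorem sum_symmZeroDiag_disjSum [DecidableEq F] {M : Type*} [AddCommMonoid M] (T : Finset Unit)
    (S : Finset ι) (f : Matrix (Unit ⊕ ι) (Unit ⊕ ι) F → M) :
    ∑ A ∈ symmZeroDiag F (T.disjSum S), f A =
      ∑ B ∈ symmZeroDiag F S, ∑ v : ι → F, ∑ a with () ∈ T → a = 0, f (bordered a v B) := by
  simp_rw [← sum_product' _ _ fun v a => f (bordered a v _)]
  rw [← sum_product' _ _ fun B (x : (ι → F) × F) => f (bordered x.2 x.1 B)]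
  refine (sum_bij' (fun x _ => bordered x.2.2 x.2.1 x.1)
    (fun A _ => (A.toBlocks₂₂, fun i => A (.inl ()) (.inr i), A (.inl ()) (.inl ())))
    ?_ ?_ ?_ ?_ ?_).symm
  · intro x hx
    simpa [bordered_mem_symmZeroDiag_disjSum] using hx
  · intro A hA
    rw [← bordered_toBlocks (mem_symmZeroDiag.1 hA).1, bordered_mem_symmZeroDiag_disjSum] at hA
    simpa using hA
  · exact fun x _ => rfl
  · exact fun A hA => bordered_toBlocks (mem_symmZeroDiag.1 hA).1
  · exact fun x _ => rfl

theorem sum_symmZeroDiag_empty_sub {M : Type*} [AddCommMonoid M] {C : Matrix ι ι F}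
    (hC : C.IsSymm) (f : Matrix ι ι F → M) :
    ∑ B ∈ symmZeroDiag F ∅, f (B - C) = ∑ B ∈ symmZeroDiag F ∅, f B := by
  refine sum_equiv (Equiv.subRight C) (fun B => ?_) fun B _ => rfl
  simp only [mem_symmZeroDiag, notMem_empty, false_imp_iff, implies_true, and_true,
    Equiv.subRight_apply]
  exact ⟨fun hB => hB.sub hC, fun hB => by simpa using hB.add hC⟩

end SymmetricMatrices

theorem exists_equiv_forall_mem_iff {ι κ : Type*} [Fintype ι] [Fintype κ] {S : Finset ι}
    {T : Finset κ} (hcard : Fintype.card ι = Fintype.card κ) (hST : #S = #T) :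
    ∃ e : ι ≃ κ, ∀ i, e i ∈ T ↔ i ∈ S := by
  classical
  let e₀ := Fintype.equivOfCardEq hcard
  let e₁ : S.map e₀.toEmbedding ≃ T := equivOfCardEq (by rw [card_map, hST])
  have hmem (i : ι) : i ∈ S ↔ e₀ i ∈ S.map e₀.toEmbedding := by simp
  refine ⟨e₀.trans e₁.extendSubtype, fun i => ?_⟩
  rw [hmem]
  exact ⟨not_imp_not.1 (e₁.extendSubtype_not_mem _), e₁.extendSubtype_mem _⟩

section DetCharSum

variable {F : Type*} [Field F] [Fintype F] {ι : Type*} [Fintype ι] [DecidableEq ι] {R : Type*}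
  [CommRing R]

/-- The sum of `η (det A)` over the symmetric `n × n` matrices `A` whose first `k` diagonal entries
vanish. Since `η` vanishes at zero, only invertible matrices contribute. -/
noncomputable def detCharSum (η : MulChar F R) (n k : ℕ) : R :=
  ∑ A ∈ symmZeroDiag F {i : Fin n | (i : ℕ) < k}, η A.det

theorem sum_symmZeroDiag_mulChar_det (η : MulChar F R) {S : Finset ι} {n k : ℕ}
    (hn : Fintype.card ι = n) (hS : #S = k) :
    ∑ A ∈ symmZeroDiag F S, η A.det = detCharSum η n k := by
  have hk : k ≤ n := hn ▸ hS ▸ card_le_univ S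
  obtain ⟨e, he⟩ := exists_equiv_forall_mem_iff (S := S) (T := {i : Fin n | (i : ℕ) < k})
    (by simpa using hn) (by rw [hS, Fin.card_filter_val_lt, min_eq_right hk])
  refine sum_equiv (reindex e e) (fun A => ?_) fun A _ => by
    rw [reindex_apply, det_submatrix_equiv_self]
  rw [mem_symmZeroDiag, mem_symmZeroDiag]
  refine and_congr ⟨fun h => h.submatrix _, fun h => by simpa using h.submatrix e⟩
    (e.forall_congr fun i => ?_)
  rw [he, reindex_apply, submatrix_apply, e.symm_apply_apply]

theorem detCharSum_zero_zero (η : MulChar F R) : detCharSum η 0 0 = 1 := by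
  have hall : symmZeroDiag F {i : Fin 0 | (i : ℕ) < 0} = {1} := by
    ext A
    simp [mem_symmZeroDiag, Subsingleton.elim A 1]
  rw [detCharSum, hall, sum_singleton, det_one, map_one]

theorem map_detCharSum {R' : Type*} [CommRing R'] (f : R →+* R') (η : MulChar F R) (n k : ℕ) :
    f (detCharSum η n k) = detCharSum (η.ringHomComp f) n k :=
  map_sum f _ _

theorem detCharSum_succ_eq_sum_bordered (η : MulChar F R) {n k : ℕ} (hk : k ≤ n) :
    detCharSum η (n + 1) k = ∑ B ∈ symmZeroDiag F {i : Fin n | (i : ℕ) < k},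
      ∑ v, ∑ a, η (bordered a v B).det := by
  classical
  rw [← sum_symmZeroDiag_mulChar_det η (ι := Unit ⊕ Fin n) (S := (∅ : Finset Unit).disjSum
    {i : Fin n | (i : ℕ) < k}) (by simp [add_comm]) (by simpa [Fin.card_filter_val_lt] using hk),
    sum_symmZeroDiag_disjSum]
  simp only [notMem_empty, false_imp_iff, filter_true]

theorem detCharSum_succ_succ_eq_sum_bordered (η : MulChar F R) {n k : ℕ} (hk : k ≤ n) :
    detCharSum η (n + 1) (k + 1) = ∑ B ∈ symmZeroDiag F {i : Fin n | (i : ℕ) < k},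
      ∑ v, η (bordered 0 v B).det := by
  classical
  have hzero : ({a | () ∈ ({()} : Finset Unit) → a = 0} : Finset F) = {0} := by
    ext
    simp
  rw [← sum_symmZeroDiag_mulChar_det η (ι := Unit ⊕ Fin n) (S := ({()} : Finset Unit).disjSum
    {i : Fin n | (i : ℕ) < k}) (by simp [add_comm])
    (by simpa [Fin.card_filter_val_lt, add_comm] using hk), sum_symmZeroDiag_disjSum]
  simp only [hzero, sum_singleton]

theorem sum_mulChar_det_bordered_symmZeroDiag_empty (η : MulChar F R) {a : F} (ha : a ≠ 0)
    (v : ι → F) :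
    ∑ B ∈ symmZeroDiag F ∅, η (bordered a v B).det =
      η a * ∑ B ∈ symmZeroDiag F (∅ : Finset ι), η B.det := by
  have hsymm : (a⁻¹ • vecMulVec v v).IsSymm := .smul (transpose_vecMulVec v v) _
  rw [← sum_symmZeroDiag_empty_sub hsymm fun B => η B.det, mul_sum]
  exact sum_congr rfl fun B _ => by rw [det_bordered_of_corner_ne_zero ha, map_mul]

theorem detCharSum_succ_zero (η : MulChar F R) (n : ℕ) :
    detCharSum η (n + 1) 0 =
      detCharSum η (n + 1) 1 + Fintype.card F ^ n * (∑ a, η a) * detCharSum η n 0 := by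
  classical
  have hcorner (v : Fin n → F) :
      ∑ B ∈ symmZeroDiag F {i : Fin n | (i : ℕ) < 0}, ∑ a, η (bordered a v B).det =
        ∑ B ∈ symmZeroDiag F {i : Fin n | (i : ℕ) < 0}, η (bordered 0 v B).det +
          (∑ a, η a) * detCharSum η n 0 := by
    have hempty : ({i : Fin n | (i : ℕ) < 0} : Finset (Fin n)) = ∅ := by simp
    simp_rw [Fintype.sum_eq_add_sum_compl (0 : F), sum_add_distrib]
    rw [MulChar.map_nonunit η not_isUnit_zero, zero_add, sum_comm, sum_mul, detCharSum, hempty]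
    exact congrArg _ (sum_congr rfl fun a ha =>
      sum_mulChar_det_bordered_symmZeroDiag_empty η (by simpa using ha) v)
  rw [detCharSum_succ_eq_sum_bordered η n.zero_le,
    detCharSum_succ_succ_eq_sum_bordered η n.zero_le, sum_comm,
    sum_congr rfl fun v _ => hcorner v, sum_add_distrib, sum_comm]
  simp [mul_assoc]

variable [IsDomain R]

theorem card_mul_detCharSum_succ_succ_eq_sum_addChar (η : MulChar F R) {ψ : AddChar F R}
    (hψ : ψ.IsPrimitive) {n k : ℕ} (hk : k ≤ n) :
    Fintype.card F * detCharSum η (n + 1) (k + 1) =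
      ∑ d, ∑ B ∈ symmZeroDiag F {i : Fin n | (i : ℕ) < k},
        ∑ v, ∑ a, η (bordered a v B).det * ψ (d * a) := by
  classical
  have hdetect (v : Fin n → F) (B : Matrix (Fin n) (Fin n) F) :
      ∑ d, ∑ a, η (bordered a v B).det * ψ (d * a) =
        Fintype.card F * η (bordered 0 v B).det := by
    rw [sum_comm]
    simp_rw [← mul_sum, AddChar.sum_mulShift _ hψ]
    simp [mul_comm]
  symm
  rw [detCharSum_succ_succ_eq_sum_bordered η hk, mul_sum, sum_comm]
  refine sum_congr rfl fun B _ => ?_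
  rw [sum_comm, mul_sum]
  exact sum_congr rfl fun v _ => hdetect v B

variable [DecidableEq F]

theorem sum_mulChar_det_bordered (hF : ringChar F ≠ 2) (η : MulChar F R)
    {ψ : AddChar F R} (hψ : ψ.IsPrimitive) {B : Matrix ι ι F} (hB : B.IsSymm) :
    ∑ v, ∑ a, η (bordered a v B).det * ψ a =
      gaussSum η ψ * gaussSum (quadraticMulChar F R) ψ ^ Fintype.card ι *
        (η * quadraticMulChar F R) B.det := by
  by_cases hdet : B.det = 0
  · have hconst (a : F) (v : ι → F) : (bordered a v B).det = (bordered 0 v B).det := by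
      rw [det_bordered_eq_add, hdet, mul_zero, zero_add]
    have hψ1 : ψ ≠ 1 := by simpa using hψ one_ne_zero
    simp_rw [hconst, ← mul_sum, AddChar.sum_eq_zero_of_ne_one hψ1]
    simp [hdet, MulChar.map_zero]
  have hborder (v : ι → F) : ∑ a, η (bordered a v B).det * ψ a =
      η B.det * gaussSum η ψ * ψ (v ⬝ᵥ B⁻¹ *ᵥ v) := calc
    ∑ a, η (bordered a v B).det * ψ a =
        ∑ a, η ((a + v ⬝ᵥ B⁻¹ *ᵥ v - v ⬝ᵥ B⁻¹ *ᵥ v) * B.det) * ψ (a + v ⬝ᵥ B⁻¹ *ᵥ v) := by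
      simp_rw [det_bordered_of_det_ne_zero _ _ hdet]
      rw [← Equiv.sum_comp (Equiv.addRight (v ⬝ᵥ B⁻¹ *ᵥ v))]
      rfl
    _ = η B.det * gaussSum η ψ * ψ (v ⬝ᵥ B⁻¹ *ᵥ v) := by
      rw [gaussSum, mul_sum, sum_mul]
      refine sum_congr rfl fun a _ => ?_
      rw [add_sub_cancel_right, map_mul, AddChar.map_add_eq_mul]
      ring
  rw [sum_congr rfl fun v _ => hborder v, ← mul_sum,
    sum_addChar_dotProduct_mulVec hF hψ hB.inv (isUnit_nonsing_inv_det B (.mk0 _ hdet)).ne_zero,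
    det_nonsing_inv, Ring.inverse_eq_inv', quadraticMulChar_inv, MulChar.mul_apply]
  ring

theorem sum_mulChar_det_bordered_mulShift (hF : ringChar F ≠ 2) (η : MulChar F R)
    {ψ : AddChar F R} (hψ : ψ.IsPrimitive) {B : Matrix ι ι F} (hB : B.IsSymm) {d : F}
    (hd : d ≠ 0) :
    ∑ v, ∑ a, η (bordered a v B).det * ψ (d * a) =
      (η * quadraticMulChar F R ^ Fintype.card ι)⁻¹ d * gaussSum η ψ *
        gaussSum (quadraticMulChar F R) ψ ^ Fintype.card ι *
        (η * quadraticMulChar F R) B.det := by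
  lift d to Fˣ using hd.isUnit
  have hshift (θ : MulChar F R) : gaussSum θ (ψ.mulShift d) = θ⁻¹ d * gaussSum θ ψ :=
    gaussSum_mulShift_eq θ ψ d
  have h := sum_mulChar_det_bordered hF η (AddChar.IsPrimitive.of_ne_one (hψ hd)) hB
  simp only [AddChar.mulShift_apply, hshift, mul_pow] at h
  rw [h, mul_inv, ← inv_pow, MulChar.mul_apply η⁻¹, MulChar.pow_apply_coe]
  ring

theorem card_mul_detCharSum_succ_succ (hF : ringChar F ≠ 2) (η : MulChar F R) {ψ : AddChar F R}
    (hψ : ψ.IsPrimitive) {n k : ℕ} (hk : k ≤ n) :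
    Fintype.card F * detCharSum η (n + 1) (k + 1) = detCharSum η (n + 1) k +
      (∑ d, (η * quadraticMulChar F R ^ n)⁻¹ d) *
        (gaussSum η ψ * gaussSum (quadraticMulChar F R) ψ ^ n *
          detCharSum (η * quadraticMulChar F R) n k) := by
  have hfreq {d : F} (hd : d ≠ 0) : ∑ B ∈ symmZeroDiag F {i : Fin n | (i : ℕ) < k},
      ∑ v, ∑ a, η (bordered a v B).det * ψ (d * a) =
        (η * quadraticMulChar F R ^ n)⁻¹ d *
          (gaussSum η ψ * gaussSum (quadraticMulChar F R) ψ ^ n *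
            detCharSum (η * quadraticMulChar F R) n k) := by
    rw [detCharSum, mul_sum, mul_sum]
    refine sum_congr rfl fun B hB => ?_
    rw [sum_mulChar_det_bordered_mulShift hF η hψ (mem_symmZeroDiag.1 hB).1 hd, Fintype.card_fin]
    ring
  rw [card_mul_detCharSum_succ_succ_eq_sum_addChar η hψ hk, Fintype.sum_eq_add_sum_compl 0,
    sum_congr rfl fun d hd => hfreq (by simpa using hd), ← sum_mul,
    Fintype.sum_eq_add_sum_compl 0 fun d => (η * quadraticMulChar F R ^ n)⁻¹ d,
    MulChar.map_zero, zero_add, detCharSum_succ_eq_sum_bordered η hk]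
  simp only [zero_mul, AddChar.map_zero_eq_one, mul_one]

end DetCharSum

section Recurrences

variable {F : Type*} [Field F] [Fintype F]

theorem sum_mulChar_one {R : Type*} [CommRing R] :
    ∑ a, (1 : MulChar F R) a = Fintype.card F - 1 := by
  classical
  rw [MulChar.sum_one_eq_card_units, Fintype.card_units, Nat.cast_pred Fintype.card_pos]

theorem one_lt_card_rat : (1 : ℚ) < Fintype.card F :=
  mod_cast Fintype.one_lt_card

variable [DecidableEq F]

theorem card_mul_detCharSum_of_ne_one (hF : ringChar F ≠ 2) {η : MulChar F ℚ} {n k : ℕ}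
    (hη : η * quadraticMulChar F ℚ ^ n ≠ 1) (hk : k ≤ n) :
    Fintype.card F * detCharSum η (n + 1) (k + 1) = detCharSum η (n + 1) k := by
  have hinj := (algebraMap ℚ ℂ).injective
  have hsum : ∑ d, (η.ringHomComp (algebraMap ℚ ℂ) * quadraticMulChar F ℂ ^ n)⁻¹ d = 0 := by
    refine MulChar.sum_eq_zero_of_ne_one (inv_ne_one.2 ?_)
    rw [← quadraticMulChar_ringHomComp (algebraMap ℚ ℂ), MulChar.ringHomComp_pow,
      ← MulChar.ringHomComp_mul]
    exact (MulChar.ringHomComp_ne_one_iff hinj).2 hη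
  apply hinj
  rw [map_mul, map_natCast, map_detCharSum, map_detCharSum, card_mul_detCharSum_succ_succ hF _
    (AddChar.FiniteField.primitiveChar_to_Complex_isPrimitive F) hk, hsum, zero_mul, add_zero]

theorem card_mul_detCharSum_one_odd (hF : ringChar F ≠ 2) {m k : ℕ} (hk : k ≤ 2 * m) :
    Fintype.card F * detCharSum (1 : MulChar F ℚ) (2 * m + 1) (k + 1) =
      detCharSum (1 : MulChar F ℚ) (2 * m + 1) k - (Fintype.card F - 1) *
        (quadraticMulChar F ℚ (-1) * Fintype.card F) ^ m *
          detCharSum (quadraticMulChar F ℚ) (2 * m) k := by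
  have hψ := AddChar.FiniteField.primitiveChar_to_Complex_isPrimitive F
  have hψ1 : AddChar.FiniteField.primitiveChar_to_Complex F ≠ 1 := by simpa using hψ one_ne_zero
  have h := card_mul_detCharSum_succ_succ hF 1 hψ hk
  rw [isQuadratic_quadraticMulChar.pow_even (even_two_mul m), one_mul, one_mul, inv_one,
    sum_mulChar_one, gaussSum_one_left hψ1, gaussSum_quadraticMulChar_pow_two_mul hF hψ] at h
  apply (algebraMap ℚ ℂ).injective
  simp only [map_mul, map_sub, map_one, map_pow, map_natCast, map_detCharSum,
    MulChar.ringHomComp_one, quadraticMulChar_ringHomComp, ← MulChar.ringHomComp_apply]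
  rw [h]
  ring

theorem card_mul_detCharSum_quadratic_even (hF : ringChar F ≠ 2) {m k : ℕ} (hk : k ≤ 2 * m + 1) :
    Fintype.card F * detCharSum (quadraticMulChar F ℚ) (2 * m + 2) (k + 1) =
      detCharSum (quadraticMulChar F ℚ) (2 * m + 2) k + (Fintype.card F - 1) *
        (quadraticMulChar F ℚ (-1) * Fintype.card F) ^ (m + 1) *
          detCharSum (1 : MulChar F ℚ) (2 * m + 1) k := by
  have hψ := AddChar.FiniteField.primitiveChar_to_Complex_isPrimitive F
  have h := card_mul_detCharSum_succ_succ hF (quadraticMulChar F ℂ) hψ hk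
  rw [← pow_succ', ← pow_succ', ← sq, isQuadratic_quadraticMulChar.sq_eq_one,
    show 2 * m + 1 + 1 = 2 * (m + 1) by ring,
    isQuadratic_quadraticMulChar.pow_even (even_two_mul _), inv_one, sum_mulChar_one,
    gaussSum_quadraticMulChar_pow_two_mul hF hψ] at h
  apply (algebraMap ℚ ℂ).injective
  simp only [map_mul, map_add, map_sub, map_one, map_pow, map_natCast, map_detCharSum,
    MulChar.ringHomComp_one, quadraticMulChar_ringHomComp, ← MulChar.ringHomComp_apply]
  rw [show 2 * m + 2 = 2 * (m + 1) by ring, h]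
  ring

theorem detCharSum_eq_div_of_ne_one (hF : ringChar F ≠ 2) {η : MulChar F ℚ} {n k : ℕ}
    (hη : η * quadraticMulChar F ℚ ^ n ≠ 1) (hk : k ≤ n + 1) :
    detCharSum η (n + 1) k = detCharSum η (n + 1) 0 / Fintype.card F ^ k := by
  have hq : (Fintype.card F : ℚ) ≠ 0 := Nat.cast_ne_zero.2 Fintype.card_ne_zero
  induction k with
  | zero => rw [pow_zero, div_one]
  | succ k ih =>
    rw [pow_succ, ← div_div, ← ih (by omega),
      ← card_mul_detCharSum_of_ne_one hF hη (Nat.le_of_succ_le_succ hk),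
      mul_div_cancel_left₀ _ hq]

theorem detCharSum_eq_zero (hF : ringChar F ≠ 2) {η : MulChar F ℚ} {n k : ℕ} (hη : η ≠ 1)
    (hηn : η * quadraticMulChar F ℚ ^ n ≠ 1) (hk : k ≤ n + 1) : detCharSum η (n + 1) k = 0 := by
  have hstep := card_mul_detCharSum_of_ne_one hF hηn n.zero_le
  have hcorner := detCharSum_succ_zero η n
  rw [MulChar.sum_eq_zero_of_ne_one hη, mul_zero, zero_mul, add_zero, ← hstep, zero_add] at hcorner
  have hone : detCharSum η (n + 1) 1 = 0 :=
    (mul_left_eq_self₀.1 hcorner).resolve_left one_lt_card_rat.ne'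
  rw [detCharSum_eq_div_of_ne_one hF hηn hk, ← hstep, zero_add, hone, mul_zero, zero_div]

omit [DecidableEq F] in
theorem detCharSum_one_even_zero (hF : ringChar F ≠ 2) (m : ℕ) :
    detCharSum (1 : MulChar F ℚ) (2 * m + 2) 0 =
      Fintype.card F ^ (2 * m + 2) * detCharSum (1 : MulChar F ℚ) (2 * m + 1) 0 := by
  classical
  have hη : (1 : MulChar F ℚ) * quadraticMulChar F ℚ ^ (2 * m + 1) ≠ 1 := by
    rw [one_mul, isQuadratic_quadraticMulChar.pow_odd (odd_two_mul_add_one m)]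
    exact quadraticMulChar_ne_one hF
  have hstep := card_mul_detCharSum_of_ne_one hF hη (Nat.zero_le _)
  have hcorner := detCharSum_succ_zero (1 : MulChar F ℚ) (2 * m + 1)
  rw [sum_mulChar_one] at hcorner
  refine mul_left_cancel₀ (sub_pos.2 (one_lt_card_rat (F := F))).ne' ?_
  linear_combination (Fintype.card F : ℚ) * hcorner + hstep

theorem detCharSum_quadratic_even_zero (hF : ringChar F ≠ 2) (m : ℕ) :
    detCharSum (quadraticMulChar F ℚ) (2 * m + 2) 0 =
      (quadraticMulChar F ℚ (-1) * Fintype.card F) ^ (m + 1) *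
        detCharSum (1 : MulChar F ℚ) (2 * m + 1) 0 := by
  have hstep := card_mul_detCharSum_quadratic_even hF (Nat.zero_le (2 * m + 1))
  have hcorner := detCharSum_succ_zero (quadraticMulChar F ℚ) (2 * m + 1)
  rw [MulChar.sum_eq_zero_of_ne_one (quadraticMulChar_ne_one hF)] at hcorner
  refine mul_left_cancel₀ (sub_pos.2 (one_lt_card_rat (F := F))).ne' ?_
  linear_combination (Fintype.card F : ℚ) * hcorner + hstep

theorem detCharSum_one_odd_zero (hF : ringChar F ≠ 2) (m : ℕ) :
    detCharSum (1 : MulChar F ℚ) (2 * m + 1) 0 =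
      Fintype.card F ^ (2 * m + 1) * detCharSum (1 : MulChar F ℚ) (2 * m) 0 -
        (quadraticMulChar F ℚ (-1) * Fintype.card F) ^ m *
          detCharSum (quadraticMulChar F ℚ) (2 * m) 0 := by
  have hstep := card_mul_detCharSum_one_odd hF (Nat.zero_le (2 * m))
  have hcorner := detCharSum_succ_zero (1 : MulChar F ℚ) (2 * m)
  rw [sum_mulChar_one] at hcorner
  refine mul_left_cancel₀ (sub_pos.2 (one_lt_card_rat (F := F))).ne' ?_
  linear_combination (Fintype.card F : ℚ) * hcorner + hstep

omit [DecidableEq F] in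
theorem detCharSum_one_odd_zero_succ (hF : ringChar F ≠ 2) (m : ℕ) :
    detCharSum (1 : MulChar F ℚ) (2 * (m + 1) + 1) 0 =
      (Fintype.card F : ℚ) ^ (2 * m + 2) * (Fintype.card F ^ (2 * m + 3) - 1) *
        detCharSum (1 : MulChar F ℚ) (2 * m + 1) 0 := by
  classical
  have hsign : (quadraticMulChar F ℚ (-1) ^ 2) ^ (m + 1) = 1 := by
    rw [quadraticMulChar_sq (neg_ne_zero.2 one_ne_zero), one_pow]
  rw [detCharSum_one_odd_zero hF, mul_add_one, detCharSum_one_even_zero hF,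
    detCharSum_quadratic_even_zero hF]
  linear_combination -(Fintype.card F : ℚ) ^ (2 * m + 2) *
    detCharSum (1 : MulChar F ℚ) (2 * m + 1) 0 * hsign

end Recurrences

section BinomialSums

theorem binom_of_neg (n : ℕ) {r : ℤ} (hr : r < 0) : binom n r = 0 := if_neg hr.not_ge

theorem binom_of_lt (n : ℕ) {r : ℤ} (hr : (n : ℤ) < r) : binom n r = 0 := by
  rw [binom, Nat.choose_eq_zero_of_lt (by omega), Nat.cast_zero, ite_self]

theorem binom_zero_right (n : ℕ) : binom n 0 = 1 := by simp [binom]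

theorem binom_succ (n : ℕ) (r : ℤ) : binom (n + 1) r = binom n r + binom n (r - 1) := by
  rcases lt_trichotomy r 0 with hr | rfl | hr
  · rw [binom_of_neg _ hr, binom_of_neg _ hr, binom_of_neg _ (by omega), add_zero]
  · rw [binom_zero_right, binom_zero_right, binom_of_neg n (by omega), add_zero]
  · obtain ⟨s, rfl⟩ : ∃ s : ℕ, r = s + 1 := ⟨(r - 1).toNat, by omega⟩
    rw [binom, binom, binom, if_pos (by omega), if_pos (by omega), if_pos (by omega),
      show ((s : ℤ) + 1).toNat = s + 1 by omega, show ((s : ℤ) + 1 - 1).toNat = s by omega,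
      Nat.choose_succ_succ]
    push_cast
    ring

/-- The `j`-th summand in the closed form of the signed count in size `2 * m`. -/
def evenSummand (q : ℚ) (m k j : ℕ) : ℚ :=
  (-1) ^ j * (q - 1) ^ (m + j) * qDoubleFactorial q (2 * (m : ℤ) - 2 * (j : ℤ) - 1) *
    (binom k (2 * (j : ℤ)) + (q - 1) * binom k (2 * (j : ℤ) + 1))

/-- The `j`-th summand in the closed form of the count in size `2 * m + 1`. -/
def oddSummand (q : ℚ) (m k j : ℕ) : ℚ :=
  (-1) ^ j * (q - 1) ^ (m + j) * qDoubleFactorial q (2 * (m : ℤ) - 2 * (j : ℤ) + 1) *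
    (binom k (2 * (j : ℤ) - 1) + (q - 1) * binom k (2 * (j : ℤ)))

/-- The sum of all nonzero terms `evenSummand q m k j`. -/
def evenSum (q : ℚ) (m k : ℕ) : ℚ := ∑ j ∈ range (k + 1), evenSummand q m k j

/-- The sum of all nonzero terms `oddSummand q m k j`. -/
def oddSum (q : ℚ) (m k : ℕ) : ℚ := ∑ j ∈ range (k + 1), oddSummand q m k j

variable (q : ℚ) (m : ℕ)

theorem evenSummand_eq_zero {k j : ℕ} (hj : k < 2 * j) : evenSummand q m k j = 0 := by
  rw [evenSummand, binom_of_lt k (by omega), binom_of_lt k (by omega), mul_zero, add_zero, mul_zero]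

theorem oddSummand_eq_zero {k j : ℕ} (hj : k + 1 < 2 * j) : oddSummand q m k j = 0 := by
  rw [oddSummand, binom_of_lt k (by omega), binom_of_lt k (by omega), mul_zero, add_zero, mul_zero]

theorem evenSum_eq_sum_range {k N : ℕ} (hN : k < 2 * N) :
    evenSum q m k = ∑ j ∈ range N, evenSummand q m k j := by
  refine sum_congr_of_eq_on_inter (fun j _ hj => ?_) (fun j _ hj => ?_) fun _ _ _ => rfl <;>
    exact evenSummand_eq_zero q m (by rw [mem_range] at hj; omega)

theorem oddSum_eq_sum_range {k N : ℕ} (hN : k + 1 < 2 * N) :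
    oddSum q m k = ∑ j ∈ range N, oddSummand q m k j := by
  refine sum_congr_of_eq_on_inter (fun j _ hj => ?_) (fun j _ hj => ?_) fun _ _ _ => rfl <;>
    exact oddSummand_eq_zero q m (by rw [mem_range] at hj; omega)

theorem evenSummand_succ_succ (k j : ℕ) :
    evenSummand q (m + 1) (k + 1) j =
      evenSummand q (m + 1) k j + (q - 1) * oddSummand q m k j := by
  rw [evenSummand, evenSummand, oddSummand, binom_succ k, binom_succ k, add_sub_cancel_right,
    Nat.cast_succ,
    show 2 * ((m : ℤ) + 1) - 2 * (j : ℤ) - 1 = 2 * (m : ℤ) - 2 * (j : ℤ) + 1 by ring]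
  ring

theorem oddSummand_succ_succ (k j : ℕ) :
    oddSummand q m (k + 1) (j + 1) =
      oddSummand q m k (j + 1) - (q - 1) * evenSummand q m k j := by
  rw [oddSummand, oddSummand, evenSummand, binom_succ k, binom_succ k, Nat.cast_succ,
    show 2 * (m : ℤ) - 2 * ((j : ℤ) + 1) + 1 = 2 * (m : ℤ) - 2 * (j : ℤ) - 1 by ring,
    show 2 * ((j : ℤ) + 1) - 1 - 1 = 2 * (j : ℤ) by ring,
    show 2 * ((j : ℤ) + 1) - 1 = 2 * (j : ℤ) + 1 by ring]
  ring

theorem oddSummand_zero (k : ℕ) :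
    oddSummand q m k 0 = (q - 1) ^ (m + 1) * qDoubleFactorial q (2 * (m : ℤ) + 1) := by
  rw [oddSummand, Nat.cast_zero, mul_zero, sub_zero, zero_sub, binom_zero_right,
    binom_of_neg k neg_one_lt_zero]
  ring

theorem evenSum_succ_succ (k : ℕ) :
    evenSum q (m + 1) (k + 1) = evenSum q (m + 1) k + (q - 1) * oddSum q m k := by
  rw [evenSum, evenSum_eq_sum_range q _ (show k < 2 * (k + 1 + 1) by omega),
    oddSum_eq_sum_range q m (show k + 1 < 2 * (k + 1 + 1) by omega), mul_sum, ← sum_add_distrib]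
  exact sum_congr rfl fun j _ => evenSummand_succ_succ q m k j

theorem oddSum_succ (k : ℕ) :
    oddSum q m (k + 1) = oddSum q m k - (q - 1) * evenSum q m k := by
  rw [oddSum, oddSum_eq_sum_range q m (show k + 1 < 2 * (k + 1 + 1) by omega), sum_range_succ',
    sum_range_succ' (oddSummand q m k), oddSummand_zero, oddSummand_zero, evenSum, mul_sum,
    add_sub_right_comm, ← sum_sub_distrib]
  exact congrArg (· + _) (sum_congr rfl fun j _ => oddSummand_succ_succ q m k j)

theorem oddSum_zero_right :
    oddSum q m 0 = (q - 1) ^ (m + 1) * qDoubleFactorial q (2 * (m : ℤ) + 1) := by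
  rw [oddSum, zero_add, sum_range_one, oddSummand_zero]

theorem evenSum_zero_zero : evenSum q 0 0 = 1 := by
  simp [evenSum, evenSummand, binom, qDoubleFactorial]

theorem evenSum_succ_zero : evenSum q (m + 1) 0 = oddSum q m 0 := by
  simp [evenSum, evenSummand, oddSum_zero_right, binom,
    show 2 * ((m : ℤ) + 1) - 1 = 2 * (m : ℤ) + 1 by ring]

theorem sub_one_mul_qNumber (n : ℕ) : (q - 1) * qNumber q n = q ^ n - 1 := by
  rw [qNumber, zpow_natCast]
  exact mul_div_cancel_of_imp' fun h => by rw [sub_eq_zero.1 h, one_pow, sub_self]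

theorem qDoubleFactorial_add_two {n : ℤ} (hn : -1 ≤ n) :
    qDoubleFactorial q (n + 2) = qNumber q (n + 2) * qDoubleFactorial q n := by
  rw [qDoubleFactorial, show ((n + 2 + 1) / 2).toNat = ((n + 1) / 2).toNat + 1 by omega,
    prod_range_succ', mul_comm, qDoubleFactorial, Nat.cast_zero, mul_zero, sub_zero]
  exact congrArg _ (prod_congr rfl fun i _ => congrArg (qNumber q) (by push_cast; ring))

theorem oddSum_zero_zero : oddSum q 0 0 = q - 1 := by
  have h := sub_one_mul_qNumber q 1
  rw [pow_one] at h
  simpa [oddSum_zero_right, qDoubleFactorial] using h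

theorem oddSum_succ_zero : oddSum q (m + 1) 0 = (q ^ (2 * m + 3) - 1) * oddSum q m 0 := by
  have hcast : ((2 * m + 3 : ℕ) : ℤ) = 2 * (m : ℤ) + 1 + 2 := by push_cast; ring
  rw [oddSum_zero_right, oddSum_zero_right, ← sub_one_mul_qNumber, hcast,
    show 2 * ((m + 1 : ℕ) : ℤ) + 1 = 2 * (m : ℤ) + 1 + 2 by push_cast; ring,
    qDoubleFactorial_add_two q (by omega)]
  ring

end BinomialSums

section ClosedForms

variable {F : Type*} [Field F] [Fintype F]

theorem detCharSum_one_odd_zero_eq_oddSum (hF : ringChar F ≠ 2) (m : ℕ) :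
    detCharSum (1 : MulChar F ℚ) (2 * m + 1) 0 =
      (Fintype.card F : ℚ) ^ (m ^ 2 + m) * oddSum (Fintype.card F) m 0 := by
  classical
  induction m with
  | zero =>
    rw [detCharSum_one_odd_zero hF, oddSum_zero_zero]
    simp only [mul_zero, detCharSum_zero_zero]
    ring
  | succ m ih =>
    rw [detCharSum_one_odd_zero_succ hF, ih, oddSum_succ_zero]
    ring

variable [DecidableEq F]

theorem detCharSum_quadratic_even_zero_eq_evenSum (hF : ringChar F ≠ 2) (m : ℕ) :
    detCharSum (quadraticMulChar F ℚ) (2 * m) 0 =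
      quadraticMulChar F ℚ (-1) ^ m * (Fintype.card F : ℚ) ^ m ^ 2 *
        evenSum (Fintype.card F) m 0 := by
  cases m with
  | zero => simp [detCharSum_zero_zero, evenSum_zero_zero]
  | succ m =>
    rw [mul_add_one, detCharSum_quadratic_even_zero hF, detCharSum_one_odd_zero_eq_oddSum hF,
      evenSum_succ_zero]
    ring

theorem card_pow_mul_detCharSum (hF : ringChar F ≠ 2) (k : ℕ) :
    (∀ m, k ≤ 2 * m + 1 →
      (Fintype.card F : ℚ) ^ k * detCharSum (1 : MulChar F ℚ) (2 * m + 1) k =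
        (Fintype.card F : ℚ) ^ (m ^ 2 + m) * oddSum (Fintype.card F) m k) ∧
    ∀ m, k ≤ 2 * m →
      (Fintype.card F : ℚ) ^ k * detCharSum (quadraticMulChar F ℚ) (2 * m) k =
        quadraticMulChar F ℚ (-1) ^ m * (Fintype.card F : ℚ) ^ m ^ 2 *
          evenSum (Fintype.card F) m k := by
  induction k with
  | zero =>
    simp only [pow_zero, one_mul]
    exact ⟨fun m _ => detCharSum_one_odd_zero_eq_oddSum hF m,
      fun m _ => detCharSum_quadratic_even_zero_eq_evenSum hF m⟩
  | succ k ih =>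
    obtain ⟨ihOdd, ihEven⟩ := ih
    refine ⟨fun m hk => ?_, fun m hk => ?_⟩
    · have hsign : (quadraticMulChar F ℚ (-1) ^ 2) ^ m = 1 := by
        rw [quadraticMulChar_sq (neg_ne_zero.2 one_ne_zero), one_pow]
      have hkm : k ≤ 2 * m := Nat.le_of_succ_le_succ hk
      rw [pow_succ, mul_assoc, card_mul_detCharSum_one_odd hF hkm, oddSum_succ]
      linear_combination ihOdd m (by omega) - (Fintype.card F - 1) *
        (quadraticMulChar F ℚ (-1) * Fintype.card F) ^ m * ihEven m hkm -
        (Fintype.card F - 1) * (Fintype.card F : ℚ) ^ (m ^ 2 + m) *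
          evenSum (Fintype.card F) m k * hsign
    · obtain ⟨m, rfl⟩ : ∃ l, m = l + 1 := Nat.exists_eq_add_one.2 (by omega)
      have hkm : k ≤ 2 * m + 1 := by omega
      rw [pow_succ, mul_assoc, mul_add_one, card_mul_detCharSum_quadratic_even hF hkm,
        evenSum_succ_succ]
      linear_combination ihEven (m + 1) (by omega) + (Fintype.card F - 1) *
        (quadraticMulChar F ℚ (-1) * Fintype.card F) ^ (m + 1) * ihOdd m hkm

end ClosedForms

section Counts

variable {F : Type*} [Field F]

theorem sym_eq_symz_zero (n : ℕ) : sym F n = symz F n 0 := by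
  simp [sym, symz, SymInv, Symz]

variable [Fintype F]

theorem symz_eq_detCharSum (n k : ℕ) : (symz F n k : ℚ) = detCharSum (1 : MulChar F ℚ) n k := by
  classical
  have hset : Symz F n k =
      ({A ∈ symmZeroDiag F {i : Fin n | (i : ℕ) < k} | IsUnit A.det} : Finset _) := by
    ext A
    simp only [Symz, Set.mem_ofPred_eq, coe_filter, mem_symmZeroDiag, mem_filter, mem_univ,
      true_and, isUnit_iff_isUnit_det]
    tauto
  rw [symz, hset, Set.ncard_coe_finset, card_filter, Nat.cast_sum, detCharSum]
  refine sum_congr rfl fun A _ => ?_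
  split_ifs with hA
  · rw [MulChar.one_apply hA, Nat.cast_one]
  · rw [MulChar.map_nonunit _ hA, Nat.cast_zero]

variable [DecidableEq F]

theorem two_mul_symzPlus_eq_detCharSum_add (n k : ℕ) :
    2 * (symzPlus F n k : ℚ) =
      detCharSum (1 : MulChar F ℚ) n k + detCharSum (quadraticMulChar F ℚ) n k := by
  have hset : SymzPlus F n k = ({A ∈ symmZeroDiag F {i : Fin n | (i : ℕ) < k} |
      quadraticChar F A.det = 1} : Finset _) := by
    ext A
    have hunit (h : quadraticChar F A.det = 1) : IsUnit A.det := by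
      by_contra hA
      simp [MulChar.map_nonunit _ hA] at h
    simp only [SymzPlus, Symz, Set.mem_ofPred_eq, coe_filter, mem_symmZeroDiag, mem_filter,
      mem_univ, true_and, isUnit_iff_isUnit_det]
    tauto
  rw [symzPlus, hset, Set.ncard_coe_finset, card_filter, Nat.cast_sum, mul_sum, detCharSum,
    detCharSum, ← sum_add_distrib]
  refine sum_congr rfl fun A _ => ?_
  rw [quadraticMulChar_apply]
  rcases eq_or_ne A.det 0 with hA | hA
  · simp [hA, MulChar.map_zero]
  · rw [MulChar.one_apply hA.isUnit]
    rcases quadraticChar_dichotomy hA with h | h <;> rw [h] <;> norm_num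

theorem neg_one_pow_signExp (m : ℕ) :
    (-1 : ℚ) ^ signExp F m = quadraticMulChar F ℚ (-1) ^ m := by
  have hne : (-1 : F) ^ m ≠ 0 := pow_ne_zero _ (neg_ne_zero.2 one_ne_zero)
  rw [← map_pow, quadraticMulChar_apply, signExp]
  split_ifs with h
  · rw [(quadraticChar_one_iff_isSquare hne).2 h, pow_zero, Int.cast_one]
  · rw [quadraticChar_neg_one_iff_not_isSquare.2 h, pow_one, Int.cast_neg, Int.cast_one]

end Counts

section CountFormulas

variable {F : Type*} [Field F] [Fintype F]

theorem symz_two_mul (hF : ringChar F ≠ 2) {m k : ℕ} (hk : k ≤ 2 * m) :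
    (symz F (2 * m) k : ℚ) = sym F (2 * m) / Fintype.card F ^ k := by
  classical
  rw [sym_eq_symz_zero, symz_eq_detCharSum, symz_eq_detCharSum]
  cases m with
  | zero => rw [Nat.le_zero.1 hk, pow_zero, div_one]
  | succ m =>
    refine detCharSum_eq_div_of_ne_one (n := 2 * m + 1) hF ?_ hk
    rw [one_mul, isQuadratic_quadraticMulChar.pow_odd (odd_two_mul_add_one m)]
    exact quadraticMulChar_ne_one hF

theorem symz_two_mul_add_one (hF : ringChar F ≠ 2) {m k : ℕ} (hk : k ≤ 2 * m + 1) :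
    (symz F (2 * m + 1) k : ℚ) =
      (Fintype.card F : ℚ) ^ (m ^ 2 + m) / Fintype.card F ^ k * oddSum (Fintype.card F) m k := by
  classical
  have hq : (Fintype.card F : ℚ) ^ k ≠ 0 := pow_ne_zero _ (Nat.cast_ne_zero.2 Fintype.card_ne_zero)
  rw [symz_eq_detCharSum, div_mul_eq_mul_div, eq_div_iff hq, mul_comm,
    (card_pow_mul_detCharSum hF k).1 m hk]

variable [DecidableEq F]

theorem symzPlus_two_mul (hF : ringChar F ≠ 2) {m k : ℕ} (hk : k ≤ 2 * m) :
    (symzPlus F (2 * m) k : ℚ) = sym F (2 * m) / (2 * Fintype.card F ^ k) +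
      (-1) ^ signExp F m * Fintype.card F ^ m ^ 2 / (2 * Fintype.card F ^ k) *
        evenSum (Fintype.card F) m k := by
  have hq : (Fintype.card F : ℚ) ^ k ≠ 0 := pow_ne_zero _ (Nat.cast_ne_zero.2 Fintype.card_ne_zero)
  have hcount := two_mul_symzPlus_eq_detCharSum_add (F := F) (2 * m) k
  have hsigned := (card_pow_mul_detCharSum hF k).2 m hk
  rw [← symz_eq_detCharSum, symz_two_mul hF hk] at hcount
  rw [neg_one_pow_signExp]
  field_simp at hcount ⊢
  linear_combination hcount + hsigned

theorem symzPlus_two_mul_add_one (hF : ringChar F ≠ 2) {m k : ℕ} (hk : k ≤ 2 * m + 1) :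
    (symzPlus F (2 * m + 1) k : ℚ) = 1 / 2 * symz F (2 * m + 1) k := by
  have hsigned : detCharSum (quadraticMulChar F ℚ) (2 * m + 1) k = 0 := by
    refine detCharSum_eq_zero hF (quadraticMulChar_ne_one hF) ?_ hk
    rw [isQuadratic_quadraticMulChar.pow_even (even_two_mul m), mul_one]
    exact quadraticMulChar_ne_one hF
  rw [symz_eq_detCharSum]
  linear_combination two_mul_symzPlus_eq_detCharSum_add (F := F) (2 * m + 1) k / 2 + hsigned / 2

end CountFormulas

theorem mainTheorem5 {F : Type*} [Field F] [Fintype F] [DecidableEq F]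
    (q : ℕ) (hq : Fintype.card F = q) (hodd : Odd q) (m k : ℕ) :
    (k + 1 ≤ 2 * m →
      (symz F (2 * m) (k + 1) : ℚ) = 1 / (q : ℚ) ^ (k + 1) * (sym F (2 * m) : ℚ)) ∧
    (k + 1 ≤ 2 * m + 1 →
      (symz F (2 * m + 1) (k + 1) : ℚ) =
        (q : ℚ) ^ (m ^ 2 + m) / (q : ℚ) ^ (k + 1) *
          ∑ j ∈ Finset.range (k / 2 + 2),
            (-1 : ℚ) ^ j * ((q : ℚ) - 1) ^ (m + j) *
              qDoubleFactorial (q : ℚ) (2 * (m : ℤ) - 2 * (j : ℤ) + 1) *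
              (binom (k + 1) (2 * (j : ℤ) - 1) +
                ((q : ℚ) - 1) * binom (k + 1) (2 * (j : ℤ)))) ∧
    (k + 1 ≤ 2 * m →
      (symzPlus F (2 * m) (k + 1) : ℚ) =
        (sym F (2 * m) : ℚ) / (2 * (q : ℚ) ^ (k + 1)) +
          (-1 : ℚ) ^ signExp F m * (q : ℚ) ^ (m ^ 2) / (2 * (q : ℚ) ^ (k + 1)) *
            ∑ j ∈ Finset.range ((k + 1) / 2 + 1),
              (-1 : ℚ) ^ j * ((q : ℚ) - 1) ^ (m + j) *
                qDoubleFactorial (q : ℚ) (2 * (m : ℤ) - 2 * (j : ℤ) - 1) *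
                (binom (k + 1) (2 * (j : ℤ)) +
                  ((q : ℚ) - 1) * binom (k + 1) (2 * (j : ℤ) + 1))) ∧
    (k + 1 ≤ 2 * m + 1 →
      (symzPlus F (2 * m + 1) (k + 1) : ℚ) =
        1 / 2 * (symz F (2 * m + 1) (k + 1) : ℚ)) := by
  subst hq
  have hF : ringChar F ≠ 2 := fun h =>
    Nat.not_even_iff_odd.2 hodd (Nat.even_iff.2 (FiniteField.even_card_iff_char_two.1 h))
  refine ⟨fun hk => ?_, fun hk => ?_, fun hk => ?_, fun hk => symzPlus_two_mul_add_one hF hk⟩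
  · rw [symz_two_mul hF hk, one_div_mul_eq_div]
  · rw [symz_two_mul_add_one hF hk,
      oddSum_eq_sum_range _ m (show k + 1 + 1 < 2 * (k / 2 + 2) by omega)]
    rfl
  · rw [symzPlus_two_mul hF hk,
      evenSum_eq_sum_range _ m (show k + 1 < 2 * ((k + 1) / 2 + 1) by omega)]
    rfl
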